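/- Let $n \ge 1$ and let $(W,S)$ be a finite Coxeter system of type $A_n$, with $S=\{s_1,\dots,s_n\}$ numbered along the Coxeter graph (so that $s_i s_{i+1}$ has order $3$, and $s_i s_j$ has order $2$ if $|i-j|\ge 2$). Let $\ell$ be the length function of $W$ with respect to $S$. For $J\subseteq S$ put \[ X_J=\{w\in W : \ell(ws)>\ell(w)\text{ for all } s\in J\},\qquad x_J=\sum_{w\in X_J} w\in\mathbb{Q}W . \] Let $\Sigma(W)=\sum_{J\subseteq S}\mathbb{Q}x_J$ be the descent algebra of $W$. For $0\le j\le n$ write $x_j=x_{\{s_1,\dots,s_j\}}$, put $x_{-1}:=x_0$, and let $\mathfrak{E}(W)=\mathbb{Q}[x_{n-1}]$ be the unital subalgebra of $\mathbb{Q}W$ generated by $x_{n-1}$. Then, for $0\le j,k\le n$, \[ x_j\,x_k=\sum_{l=-1}^{\min(j,k)}\binom{n-j}{k-l}\binom{n-k}{j-l}(n-j-k+l)!\;x_l , \] where a term with $n-j-k+l<0$ is read as $0$ (its binomial coefficients vanish). Moreover $\mathfrak{E}(W)\subseteq\Sigma(W)$, and the elements $x_0,x_1,\dots,x_n$ form a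 native basis of $\mathfrak{E}(W)$, that is, a basis contained in $\{x_J : J\subseteq S\}$. The numbers above are the structure constants of $\mathfrak{E}(W)$ with respect to this basis: the coefficient of $x_l$ in $x_jx_k$ is $\binom{n-j}{k-l}\binom{n-k}{j-l}(n-j-k+l)!$ if $1\le l\le\min(j,k)$, it is the sum of the terms for $l=0$ and $l=-1$ if $l=0$, and it is $0$ if $l>\min(j,k)$. -/

import Mathlib

noncomputable section

namespace NativeDescent

variable {B : Type*} {M : CoxeterMatrix B} {W : Type*} [Group W]

/-- `X_J = {w ∈ W : ℓ(w s) > ℓ(w) for all s ∈ J}`, the distinguished transversal of the left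
cosets of the parabolic subgroup `W_J`. A subset `J` of the Coxeter generators is given by the
set of its labels. -/
def transversal (cs : CoxeterSystem M W) (J : Set B) : Set W :=
  {w | ∀ i ∈ J, cs.length w < cs.length (w * cs.simple i)}

/-- `x_J = ∑_{w ∈ X_J} w` in the rational group algebra `ℚ W` of a finite Coxeter system. -/
def xElt [Finite W] (cs : CoxeterSystem M W) (J : Set B) : MonoidAlgebra ℚ W :=
  ∑ w ∈ (transversal cs J).toFinite.toFinset, MonoidAlgebra.of ℚ W w

/-- The underlying rational vector space `∑_{J ⊆ S} ℚ x_J` of the descent algebra `Σ(W)`. -/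
def descentSpace [Finite W] (cs : CoxeterSystem M W) : Submodule ℚ (MonoidAlgebra ℚ W) :=
  Submodule.span ℚ (Set.range (xElt cs))

/-- A basis of a subalgebra `E ⊆ Σ(W)` is native if it is a subset of `{x_J : J ⊆ S}`. -/
def IsNative [Finite W] (cs : CoxeterSystem M W) {ι : Type*}
    {E : Subalgebra ℚ (MonoidAlgebra ℚ W)} (b : Module.Basis ι ℚ E) : Prop :=
  Subalgebra.toSubmodule E ≤ descentSpace cs ∧
    ∀ i, ∃ J : Set B, (b i : MonoidAlgebra ℚ W) = xElt cs J

/-- `x_j = x_J` with `J = {s_1, …, s_j}`, in type `A_n`. The generator `s_{i+1}` has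
the label `i : Fin n`. -/
def xA [Finite W] {n : ℕ} (cs : CoxeterSystem (CoxeterMatrix.A n) W) (j : ℕ) :
    MonoidAlgebra ℚ W :=
  xElt cs {i : Fin n | (i : ℕ) + 1 ≤ j}

/-- `𝔈(W) = ℚ[x_{n-1}]`, in type `A_n` with `n ≥ 1`. -/
def algE [Finite W] {n : ℕ} (cs : CoxeterSystem (CoxeterMatrix.A n) W) :
    Subalgebra ℚ (MonoidAlgebra ℚ W) :=
  Algebra.adjoin ℚ {xA cs (n - 1)}

/-- The coefficient `C(n-j, k-l) C(n-k, j-l) (n-j-k+l)!`, for `0 ≤ j, k ≤ n` and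
`-1 ≤ l ≤ min(j, k)`. If `n-j-k+l < 0` then `k-l > n-j`, so that the value is zero. -/
def coeffA (n j k : ℕ) (l : ℤ) : ℕ :=
  (n - j).choose ((k : ℤ) - l).toNat * (n - k).choose ((j : ℤ) - l).toNat *
    ((n : ℤ) - j - k + l).toNat.factorial

end NativeDescent

end

/-! Counting words and mapping onto the symmetric group identify W with S_{n+1}; then `s_{i+1} ∈ J`
demands an ascent at place i, so x_k is the sum of the permutations increasing on {0, …, k}. The
elements of X_{n-1} are the inverses of the n + 1 permutations `moveToLast q`. Counting how these
affect increasing beginnings gives x_{n-1} x_k = (n - k) x_k + x_{k-1} (`xA_pred_mul`). Hence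
x_{n-d} is the falling factorial of degree d evaluated at x_{n-1}, for d ≤ n + 1, and degrees above
n + 1 give 0. The product formula is therefore the linearization of a product of two falling
factorials (`descPochhammer_mul_descPochhammer`). The same recursion shows that the x_k span 𝔈(W),
and coefficients at 1 and at the generators show their independence. -/

noncomputable section

namespace NativeDescent

/-! ### Upper bound for the order of a group with the type A relations -/

section Counting

variable {G : Type*} [Group G]

/-- The product `σ a * σ (a + 1) * ⋯ * σ (a + d - 1)`. -/
def segmentProd (σ : ℕ → G) : ℕ → ℕ → G
  | _, 0 => 1
  | a, d + 1 => σ a * segmentProd σ (a + 1) d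

theorem mul_segmentProd_of_lt {σ : ℕ → G} {N j : ℕ}
    (hcomm : ∀ i j, i + 2 ≤ j → j < N → σ i * σ j = σ j * σ i) (d : ℕ) :
    ∀ a, j + 2 ≤ a → a + d ≤ N → σ j * segmentProd σ a d = segmentProd σ a d * σ j := by
  induction d with
  | zero => intro a _ _; simp [segmentProd]
  | succ d ih =>
    intro a ha hN
    rw [segmentProd, ← mul_assoc, hcomm j a ha (by omega), mul_assoc,
      ih (a + 1) (by omega) (by omega), mul_assoc]

/-- The factor `σ (j + 1)` commutes past the letters before `σ j`; the braid relation then turns it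
into a `σ j` behind `σ (j + 1)`, which commutes with the rest. -/
theorem succ_mul_segmentProd {σ : ℕ → G} {N : ℕ}
    (hbraid : ∀ i, i + 1 < N → σ i * σ (i + 1) * σ i = σ (i + 1) * σ i * σ (i + 1))
    (hcomm : ∀ i j, i + 2 ≤ j → j < N → σ i * σ j = σ j * σ i) (d : ℕ) :
    ∀ a j, a ≤ j → j + 1 < a + d → a + d ≤ N →
      σ (j + 1) * segmentProd σ a d = segmentProd σ a d * σ j := by
  induction d with
  | zero => intro a j _ _ _; omega
  | succ d ih =>
    intro a j haj hj hN
    rcases haj.eq_or_lt with rfl | haj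
    · obtain ⟨e, rfl⟩ : ∃ e, d = e + 1 := ⟨d - 1, by omega⟩
      simp only [segmentProd]
      have h := mul_segmentProd_of_lt (j := a) hcomm e (a + 1 + 1) (by omega) (by omega)
      calc _ = (σ (a + 1) * σ a * σ (a + 1)) * segmentProd σ (a + 1 + 1) e := by group
        _ = σ a * σ (a + 1) * (σ a * segmentProd σ (a + 1 + 1) e) := by
          rw [← hbraid a (by omega)]; group
        _ = _ := by rw [h]; group
    · simp only [segmentProd]
      rw [← mul_assoc, ← hcomm a (j + 1) (by omega) (by omega), mul_assoc,
        ih (a + 1) j (by omega) (by omega) (by omega), mul_assoc]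

/-- A group generated by involutions satisfying the braid relations of type `A_N` has at most
`(N + 1)!` elements. -/
theorem exists_finset_card_le_factorial {σ : ℕ → G} (N : ℕ)
    (hsq : ∀ i, i < N → σ i * σ i = 1)
    (hbraid : ∀ i, i + 1 < N → σ i * σ (i + 1) * σ i = σ (i + 1) * σ i * σ (i + 1))
    (hcomm : ∀ i j, i + 2 ≤ j → j < N → σ i * σ j = σ j * σ i) :
    ∃ S : Finset G, S.card ≤ (N + 1).factorial ∧
      (Subgroup.closure (σ '' Set.Iio N) : Set G) ⊆ S := by
  classical
  induction N with
  | zero => exact ⟨{1}, by simp, by simp⟩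
  | succ N ih =>
    obtain ⟨S, hS, hsub⟩ := ih (fun i hi => hsq i (by omega)) (fun i hi => hbraid i (by omega))
      (fun i j h hj => hcomm i j h (by omega))
    -- The N + 2 segments that end in `σ N`, the empty one included, meet every left coset of the
    -- subgroup generated by the first N letters.
    refine ⟨(Finset.range (N + 2) ×ˢ S).image
      (fun q => segmentProd σ (N + 1 - q.1) q.1 * q.2), ?_, ?_⟩
    · refine Finset.card_image_le.trans ?_
      rw [Finset.card_product, Finset.card_range, Nat.factorial_succ]
      gcongr
    · have key : ∀ g ∈ Subgroup.closure (σ '' Set.Iio (N + 1)), ∃ d ≤ N + 1,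
          ∃ h ∈ Subgroup.closure (σ '' Set.Iio N), g = segmentProd σ (N + 1 - d) d * h := by
        have step : ∀ j, j < N + 1 → ∀ y, (∃ d ≤ N + 1, ∃ h ∈ Subgroup.closure (σ '' Set.Iio N),
            y = segmentProd σ (N + 1 - d) d * h) → ∃ d ≤ N + 1,
            ∃ h ∈ Subgroup.closure (σ '' Set.Iio N), σ j * y = segmentProd σ (N + 1 - d) d * h := by
          rintro j hj _ ⟨d, hd, h, hh, rfl⟩
          have hmem : ∀ i, i < N → σ i ∈ Subgroup.closure (σ '' Set.Iio N) := fun i hi =>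
            Subgroup.subset_closure ⟨i, hi, rfl⟩
          -- Left multiplication by `σ j` lengthens the segment, shortens it, or passes through it
          -- into the subgroup.
          rcases lt_trichotomy j (N + 1 - d) with hlt | heq | hgt
          · rcases (show j + 1 ≤ N + 1 - d from hlt).eq_or_lt with he | hl
            · refine ⟨d + 1, by omega, h, hh, ?_⟩
              rw [show N + 1 - (d + 1) = j by omega, segmentProd, he, mul_assoc]
            · refine ⟨d, hd, σ j * h, mul_mem (hmem j (by omega)) hh, ?_⟩
              rw [← mul_assoc, mul_segmentProd_of_lt hcomm d _ (by omega) (by omega), mul_assoc]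
          · obtain ⟨e, rfl⟩ : ∃ e, d = e + 1 := ⟨d - 1, by omega⟩
            refine ⟨e, by omega, h, hh, ?_⟩
            rw [segmentProd, ← heq, ← mul_assoc, ← mul_assoc, hsq j hj, one_mul,
              show j + 1 = N + 1 - e by omega]
          · obtain ⟨i, rfl⟩ : ∃ i, j = i + 1 := ⟨j - 1, by omega⟩
            refine ⟨d, hd, σ i * h, mul_mem (hmem i (by omega)) hh, ?_⟩
            rw [← mul_assoc, succ_mul_segmentProd hbraid hcomm d _ i (by omega) (by omega)
              (by omega), mul_assoc]
        intro g hg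
        induction hg using Subgroup.closure_induction_left with
        | one => exact ⟨0, by omega, 1, one_mem _, by simp [segmentProd]⟩
        | mul_left x hx y hy ih =>
          obtain ⟨j, hj, rfl⟩ := hx
          exact step j hj y ih
        | inv_mul_cancel x hx y hy ih =>
          obtain ⟨j, hj, rfl⟩ := hx
          rw [inv_eq_of_mul_eq_one_right (hsq j hj)]
          exact step j hj y ih
      intro g hg
      obtain ⟨d, hd, h, hh, rfl⟩ := key g hg
      simp only [Finset.coe_image, Set.mem_image]
      exact ⟨(d, h), by simpa using ⟨by omega, hsub hh⟩, rfl⟩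

end Counting

/-! ### Identification with the symmetric group; length and descents -/

section SymmetricGroup

variable {n : ℕ} {W : Type*} [Group W]

theorem isLiftable_swap (n : ℕ) : (CoxeterMatrix.A n).IsLiftable
    (fun i : Fin n => Equiv.swap i.castSucc i.succ) := by
  intro i j
  change (Equiv.swap i.castSucc i.succ * Equiv.swap j.castSucc j.succ) ^
    (if i = j then 1 else (if (j : ℕ) + 1 = i ∨ (i : ℕ) + 1 = j then 3 else 2)) = 1
  split_ifs with h h'
  · subst h; simp
  · have key : ∀ a b c : Fin (n + 1), a ≠ b → b ≠ c → a ≠ c →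
        (Equiv.swap a b * Equiv.swap b c) ^ 3 = 1 := by
      intro a b c hab hbc hac
      have := (Equiv.Perm.isThreeCycle_swap_mul_swap_same hab.symm hbc hac).orderOf
      rw [Equiv.swap_comm b a] at this
      rw [← this, pow_orderOf_eq_one]
    rcases h' with h' | h'
    · have e : j.succ = i.castSucc := Fin.ext (by simpa using h')
      rw [← e, Equiv.swap_comm, Equiv.swap_comm j.castSucc]
      apply key <;> simp [Fin.ext_iff] <;> omega
    · have e : i.succ = j.castSucc := Fin.ext (by simpa using h')
      rw [← e]
      apply key <;> simp [Fin.ext_iff] <;> omega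
  · have hd : Equiv.Perm.Disjoint (Equiv.swap i.castSucc i.succ)
        (Equiv.swap j.castSucc j.succ) := by
      apply Equiv.Perm.disjoint_swap_swap
      simp [Fin.ext_iff] at h h' ⊢
      omega
    rw [hd.commute.mul_pow]
    simp [pow_two]

/-- The homomorphism from a Coxeter group of type `A_n` to the symmetric group on `n + 1`
letters. -/
def toPerm (cs : CoxeterSystem (CoxeterMatrix.A n) W) : W →* Equiv.Perm (Fin (n + 1)) :=
  cs.lift ⟨_, isLiftable_swap n⟩

@[simp]
theorem toPerm_simple (cs : CoxeterSystem (CoxeterMatrix.A n) W) (i : Fin n) :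
    toPerm cs (cs.simple i) = Equiv.swap i.castSucc i.succ :=
  cs.lift_apply_simple (isLiftable_swap n) i

theorem toPerm_surjective (cs : CoxeterSystem (CoxeterMatrix.A n) W) :
    Function.Surjective (toPerm cs) := by
  rw [← MonoidHom.mrange_eq_top, eq_top_iff, ← Equiv.Perm.mclosure_swap_castSucc_succ n,
    Submonoid.closure_le]
  rintro _ ⟨i, rfl⟩
  exact ⟨cs.simple i, toPerm_simple cs i⟩

theorem card_le_factorial (cs : CoxeterSystem (CoxeterMatrix.A n) W) :
    Nat.card W ≤ (n + 1).factorial := by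
  let σ : ℕ → W := fun i => if h : i < n then cs.simple ⟨i, h⟩ else 1
  have hσ : ∀ i (h : i < n), σ i = cs.simple ⟨i, h⟩ := fun i h => dif_pos h
  obtain ⟨S, hS, hsub⟩ := exists_finset_card_le_factorial (σ := σ) n
    (fun i hi => by rw [hσ i hi, cs.simple_mul_simple_self])
    (fun i hi => by
      have h := cs.simple_mul_simple_pow ⟨i, by omega⟩ ⟨i + 1, hi⟩
      have hM : CoxeterMatrix.A n ⟨i, by omega⟩ ⟨i + 1, hi⟩ = 3 := by
        simp [CoxeterMatrix.A]
      rw [hM] at h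
      rw [hσ i (by omega), hσ (i + 1) hi]
      generalize hs : cs.simple ⟨i, by omega⟩ = s at *
      generalize ht : cs.simple ⟨i + 1, hi⟩ = t at *
      have hs2 : s⁻¹ = s := hs ▸ cs.inv_simple _
      have ht2 : t⁻¹ = t := ht ▸ cs.inv_simple _
      have h' : (s * t * s) * (t * s * t) = 1 := by rw [← h]; simp [pow_succ, mul_assoc]
      rw [eq_inv_of_mul_eq_one_left h']
      simp [hs2, ht2, mul_assoc])
    (fun i j hij hj => by
      have h := cs.simple_mul_simple_pow ⟨i, by omega⟩ ⟨j, hj⟩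
      have hM : CoxeterMatrix.A n ⟨i, by omega⟩ ⟨j, hj⟩ = 2 := by
        simp only [CoxeterMatrix.A, Matrix.of_apply, Fin.mk.injEq]
        rw [if_neg (by omega), if_neg (by omega)]
      rw [hM, pow_two] at h
      rw [hσ i (by omega), hσ j hj, eq_inv_of_mul_eq_one_left h]
      simp)
  have htop : (Subgroup.closure (σ '' Set.Iio n)) = ⊤ := by
    rw [eq_top_iff, ← cs.subgroup_closure_range_simple]
    apply Subgroup.closure_mono
    rintro _ ⟨i, rfl⟩
    exact ⟨i, i.2, hσ i i.2⟩
  rw [htop] at hsub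
  have huniv : (S : Set W) = Set.univ := Set.eq_univ_of_univ_subset (by simpa using hsub)
  rw [← Set.ncard_univ, ← huniv, Set.ncard_coe_finset]
  exact hS

theorem toPerm_bijective [Finite W] (cs : CoxeterSystem (CoxeterMatrix.A n) W) :
    Function.Bijective (toPerm cs) := by
  apply (toPerm_surjective cs).bijective_of_nat_card_le
  rw [Nat.card_perm, Nat.card_fin]
  exact card_le_factorial cs

theorem eq_of_swap_castSucc_succ_lt (j : Fin n) {x y : Fin (n + 1)} (hxy : x < y)
    (h : Equiv.swap j.castSucc j.succ y < Equiv.swap j.castSucc j.succ x) :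
    x = j.castSucc ∧ y = j.succ := by
  rw [Equiv.swap_apply_def, Equiv.swap_apply_def] at h
  simp only [Fin.lt_def, Fin.ext_iff, apply_ite Fin.val, Fin.val_succ, Fin.val_castSucc] at *
  split_ifs at h <;> omega

/-- If `i` is a descent of the permutation of a word, then a letter of the word can be deleted
to obtain a word for the product with `s_i`. -/
theorem exists_wordProd_eq_mul_simple [Finite W] (cs : CoxeterSystem (CoxeterMatrix.A n) W)
    (i : Fin n) (ω : List (Fin n))
    (h : toPerm cs (cs.wordProd ω) i.succ < toPerm cs (cs.wordProd ω) i.castSucc) :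
    ∃ ω' : List (Fin n), ω'.length < ω.length ∧ cs.wordProd ω' = cs.wordProd ω * cs.simple i := by
  induction ω with
  | nil => simp at h; exact absurd h (by simp [Fin.lt_def])
  | cons j ω ih =>
    rcases lt_or_ge (toPerm cs (cs.wordProd ω) i.succ) (toPerm cs (cs.wordProd ω) i.castSucc)
      with hlt | hge
    · obtain ⟨ω', hl, hω'⟩ := ih hlt
      exact ⟨j :: ω', by simpa using hl, by rw [cs.wordProd_cons, hω', cs.wordProd_cons, mul_assoc]⟩
    -- The letter j itself creates the descent, so its transposition exchanges the values of the
    -- remaining permutation p at i and i + 1: s_j p = p s_i, and deleting j is enough.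
    · refine ⟨ω, by simp, ?_⟩
      have hne : toPerm cs (cs.wordProd ω) i.castSucc ≠ toPerm cs (cs.wordProd ω) i.succ :=
        fun e => i.castSucc_lt_succ.ne (Equiv.injective _ e)
      apply (toPerm_bijective cs).1
      rw [cs.wordProd_cons, map_mul, toPerm_simple, Equiv.Perm.mul_apply,
        Equiv.Perm.mul_apply] at h
      rw [cs.wordProd_cons, map_mul, map_mul, toPerm_simple, toPerm_simple]
      generalize toPerm cs (cs.wordProd ω) = p at *
      have hj := eq_of_swap_castSucc_succ_lt j (lt_of_le_of_ne hge hne) h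
      rw [← hj.1, ← hj.2, mul_assoc, Equiv.mul_swap_eq_swap_mul, ← mul_assoc,
        Equiv.swap_mul_self, one_mul]

theorem length_mul_simple_lt [Finite W] (cs : CoxeterSystem (CoxeterMatrix.A n) W) (w : W)
    (i : Fin n) (h : toPerm cs w i.succ < toPerm cs w i.castSucc) :
    cs.length (w * cs.simple i) < cs.length w := by
  obtain ⟨ω, hω, rfl⟩ := cs.exists_isReduced w
  obtain ⟨ω', hl, hω'⟩ := exists_wordProd_eq_mul_simple cs i ω h
  rw [← hω', hω.eq]
  exact (cs.length_wordProd_le ω').trans_lt hl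

theorem length_lt_length_mul_simple_iff [Finite W] (cs : CoxeterSystem (CoxeterMatrix.A n) W)
    (w : W) (i : Fin n) : cs.length w < cs.length (w * cs.simple i) ↔
      toPerm cs w i.castSucc < toPerm cs w i.succ := by
  constructor
  · intro h
    by_contra hn
    refine (length_mul_simple_lt cs w i (lt_of_le_of_ne (not_lt.1 hn) fun e => ?_)).not_gt h
    exact i.castSucc_lt_succ.ne' (Equiv.injective _ e)
  · intro h
    simpa using length_mul_simple_lt cs (w * cs.simple i) i (by simpa using h)

end SymmetricGroup

/-! ### Permutations with an increasing beginning -/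

section Counting

variable {n : ℕ}

/-- The permutation `p` is increasing on `{0, …, k}`. -/
def IncreasingUpTo (k : ℕ) (p : Equiv.Perm (Fin (n + 1))) : Prop :=
  ∀ i : Fin n, (i : ℕ) < k → p i.castSucc < p i.succ

theorem IncreasingUpTo.lt {k : ℕ} {p : Equiv.Perm (Fin (n + 1))} (h : IncreasingUpTo k p)
    {a b : Fin (n + 1)} (hab : a < b) (hb : (b : ℕ) ≤ k) : p a < p b := by
  induction b using Fin.induction with
  | zero => exact absurd hab (by simp)
  | succ i ih =>
    have hi := h i (by simpa using hb)
    rcases (Fin.le_castSucc_iff.2 hab).eq_or_lt with rfl | hlt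
    · exact hi
    · exact (ih hlt (by simp at hb ⊢; omega)).trans hi

theorem increasingUpTo_iff {k : ℕ} {p : Equiv.Perm (Fin (n + 1))} :
    IncreasingUpTo k p ↔ ∀ a b : Fin (n + 1), a < b → (b : ℕ) ≤ k → p a < p b :=
  ⟨fun h _ _ => h.lt, fun h i hi => h _ _ i.castSucc_lt_succ (by simpa using hi)⟩

/-- The permutation that moves `q` to the last place and keeps the other letters in order. -/
def moveToLast (q : Fin (n + 1)) : Equiv.Perm (Fin (n + 1)) :=
  (finSuccEquiv' q).trans (finSuccEquiv' (Fin.last n)).symm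

@[simp]
theorem moveToLast_self (q : Fin (n + 1)) : moveToLast q q = Fin.last n := by
  simp [moveToLast]

@[simp]
theorem moveToLast_succAbove (q : Fin (n + 1)) (i : Fin n) :
    moveToLast q (q.succAbove i) = i.castSucc := by
  simp [moveToLast]

theorem moveToLast_lt_moveToLast_iff {q a b : Fin (n + 1)} (ha : a ≠ q) (hb : b ≠ q) :
    moveToLast q a < moveToLast q b ↔ a < b := by
  obtain ⟨a, rfl⟩ := Fin.exists_succAbove_eq ha
  obtain ⟨b, rfl⟩ := Fin.exists_succAbove_eq hb
  simp

theorem moveToLast_lt_last {q a : Fin (n + 1)} (ha : a ≠ q) : moveToLast q a < Fin.last n := by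
  obtain ⟨a, rfl⟩ := Fin.exists_succAbove_eq ha
  simp [Fin.castSucc_lt_last]

theorem increasingUpTo_moveToLast_inv (q : Fin (n + 1)) :
    IncreasingUpTo (n - 1) (moveToLast q)⁻¹ := by
  intro i hi
  have hne : ∀ a : Fin (n + 1), a ≠ Fin.last n → (moveToLast q)⁻¹ a ≠ q := by
    intro a ha h
    rw [Equiv.Perm.inv_eq_iff_eq, moveToLast_self] at h
    exact ha h
  rw [← moveToLast_lt_moveToLast_iff (q := q)]
  · simp
  · exact hne _ (by simp [Fin.ext_iff]; omega)
  · exact hne _ (by simp [Fin.ext_iff]; omega)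

/-- Place q receives the maximal value and all other comparisons are those of p. A maximum before
place k destroys monotonicity; at place k it is harmless and frees p from the comparison there. -/
theorem increasingUpTo_moveToLast_mul_iff {k : ℕ} (hk : k ≤ n) (p : Equiv.Perm (Fin (n + 1)))
    (q : Fin (n + 1)) : IncreasingUpTo k (moveToLast (p q) * p) ↔
      (k < q ∧ IncreasingUpTo k p) ∨ (k = q ∧ IncreasingUpTo (k - 1) p) := by
  have hlt : ∀ {a b}, a ≠ q → b ≠ q →
      ((moveToLast (p q) * p) a < (moveToLast (p q) * p) b ↔ p a < p b) := fun ha hb =>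
    moveToLast_lt_moveToLast_iff (p.injective.ne ha) (p.injective.ne hb)
  have hlast : (moveToLast (p q) * p) q = Fin.last n := by simp
  constructor
  · intro h
    have hq : k ≤ q := by
      by_contra hn
      have := h.lt (a := q) (b := ⟨k, by omega⟩) (by simp [Fin.lt_def]; omega) le_rfl
      rw [hlast] at this
      exact (Fin.le_last _).not_gt this
    rcases hq.lt_or_eq with hq | hq
    · refine Or.inl ⟨hq, increasingUpTo_iff.2 fun a b hab hb => (hlt ?_ ?_).1 (h.lt hab hb)⟩ <;>
      · rintro rfl; simp only [Fin.lt_def] at *; omega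
    · refine Or.inr ⟨hq, fun i hi => (hlt ?_ ?_).1 (h i (by omega))⟩ <;>
      · rintro rfl; simp at hq; omega
  · rintro (⟨hq, h⟩ | ⟨hq, h⟩)
    · refine increasingUpTo_iff.2 fun a b hab hb => (hlt ?_ ?_).2 (h.lt hab hb) <;>
      · rintro rfl; simp only [Fin.lt_def] at *; omega
    · refine increasingUpTo_iff.2 fun a b hab hb => ?_
      have ha : a ≠ q := by rintro rfl; simp only [Fin.lt_def] at *; omega
      by_cases hbq : b = q
      · rw [hbq, hlast]
        exact moveToLast_lt_last (p.injective.ne ha)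
      · have : (b : ℕ) ≠ q := fun e => hbq (Fin.ext e)
        exact (hlt ha hbq).2 (h.lt hab (by omega))

theorem IncreasingUpTo.eq_one {p : Equiv.Perm (Fin (n + 1))} (h : IncreasingUpTo n p) : p = 1 := by
  have hmono : StrictMono p := Fin.strictMono_iff_lt_succ.2 fun i => h i i.2
  exact DFunLike.coe_injective ((hmono.range_inj strictMono_id).1 (by simp [p.surjective.range_eq]))

theorem IncreasingUpTo.eq_moveToLast_inv {p : Equiv.Perm (Fin (n + 1))}
    (h : IncreasingUpTo (n - 1) p) : p = (moveToLast (p (Fin.last n)))⁻¹ :=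
  eq_inv_of_mul_eq_one_right (IncreasingUpTo.eq_one
    ((increasingUpTo_moveToLast_mul_iff le_rfl p _).2 (Or.inr ⟨by simp, h⟩)))

open Classical in
theorem sum_ite_increasingUpTo {k : ℕ} (hk : k ≤ n) (p : Equiv.Perm (Fin (n + 1))) :
    ∑ q, (if IncreasingUpTo k (moveToLast q * p) then (1 : ℚ) else 0) =
      ((n : ℚ) - k) * (if IncreasingUpTo k p then 1 else 0) +
        (if IncreasingUpTo (k - 1) p then 1 else 0) := by
  -- Sum over the place of the moved value: n - k places lie beyond k, and one is k itself.
  rw [← Equiv.sum_comp p]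
  have h : ∀ q : Fin (n + 1), (if IncreasingUpTo k (moveToLast (p q) * p) then (1 : ℚ) else 0) =
      (if k < (q : ℕ) then 1 else 0) * (if IncreasingUpTo k p then 1 else 0) +
      (if q = ⟨k, by omega⟩ then 1 else 0) * (if IncreasingUpTo (k - 1) p then 1 else 0) := by
    intro q
    simp only [increasingUpTo_moveToLast_mul_iff hk, Fin.ext_iff]
    rcases lt_trichotomy k (q : ℕ) with hq | hq | hq
    · simp [hq, hq.ne, hq.ne']
    · simp [hq]
    · simp [hq.not_gt, hq.ne, hq.ne']
  simp_rw [h]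
  rw [Finset.sum_add_distrib, ← Finset.sum_mul, ← Finset.sum_mul, Finset.sum_ite_eq',
    if_pos (Finset.mem_univ _), one_mul, Finset.sum_boole]
  congr 2
  have : (Finset.univ.filter fun q : Fin (n + 1) => k < (q : ℕ)) =
    Finset.Ioi ⟨k, by omega⟩ := by ext; simp [Fin.lt_def]
  rw [this, Fin.card_Ioi]
  simp only [Nat.add_sub_cancel]
  rw [Nat.cast_sub (by omega)]

end Counting

/-! ### The recursion for multiplication by x_{n-1}, and linear independence -/

section

variable {n : ℕ} {W : Type*} [Group W] [Finite W]

theorem mem_transversal_iff (cs : CoxeterSystem (CoxeterMatrix.A n) W) (k : ℕ) (w : W) :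
    w ∈ transversal cs {i : Fin n | (i : ℕ) + 1 ≤ k} ↔ IncreasingUpTo k (toPerm cs w) := by
  simp only [transversal, Set.mem_ofPred_eq, length_lt_length_mul_simple_iff]
  rfl

open Classical in
theorem coeff_xA (cs : CoxeterSystem (CoxeterMatrix.A n) W) (k : ℕ) (w : W) :
    (xA cs k).coeff w = if IncreasingUpTo k (toPerm cs w) then 1 else 0 := by
  simp only [xA, xElt, ← mem_transversal_iff, MonoidAlgebra.coeff_sum, Finsupp.finsetSum_apply,
    MonoidAlgebra.of_apply, MonoidAlgebra.coeff_single, Finsupp.single_apply]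
  simp

theorem xA_pred_eq_sum (cs : CoxeterSystem (CoxeterMatrix.A n) W) :
    xA cs (n - 1) = ∑ q : Fin (n + 1), MonoidAlgebra.of ℚ W
      ((MulEquiv.ofBijective _ (toPerm_bijective cs)).symm (moveToLast q)⁻¹) := by
  rw [xA, xElt]
  symm
  refine Finset.sum_nbij (fun q => (MulEquiv.ofBijective _ (toPerm_bijective cs)).symm
    (moveToLast q)⁻¹) ?_ ?_ ?_ ?_
  · intro q _
    rw [Set.Finite.mem_toFinset, mem_transversal_iff]
    convert increasingUpTo_moveToLast_inv q
    exact (MulEquiv.ofBijective _ (toPerm_bijective cs)).apply_symm_apply _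
  · intro q _ q' _ h
    have h' : moveToLast q = moveToLast q' := by simpa using h
    apply (moveToLast q).injective
    rw [moveToLast_self, h', moveToLast_self]
  · intro w hw
    rw [Finset.mem_coe, Set.Finite.mem_toFinset, mem_transversal_iff] at hw
    refine ⟨toPerm cs w (Fin.last n), by simp, ?_⟩
    beta_reduce
    rw [← hw.eq_moveToLast_inv]
    exact (MulEquiv.ofBijective _ (toPerm_bijective cs)).symm_apply_apply w
  · intro q _
    rfl

theorem xA_self (cs : CoxeterSystem (CoxeterMatrix.A n) W) : xA cs n = 1 := by
  classical
  ext w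
  rw [coeff_xA, MonoidAlgebra.one_def, MonoidAlgebra.coeff_single, Finsupp.single_apply]
  refine if_congr ⟨fun h => ((toPerm_bijective cs).1 (h.eq_one.trans (map_one _).symm)).symm, ?_⟩
    rfl rfl
  rintro rfl i _
  simp

/-- This is `sum_ite_increasingUpTo` read coefficientwise. For k = 0 the truncated `k - 1` is 0,
which matches x_{-1} = x_0, so x_0 has eigenvalue n + 1. -/
theorem xA_pred_mul (cs : CoxeterSystem (CoxeterMatrix.A n) W) {k : ℕ} (hk : k ≤ n) :
    xA cs (n - 1) * xA cs k = ((n : ℚ) - k) • xA cs k + xA cs (k - 1) := by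
  classical
  ext w
  rw [MonoidAlgebra.coeff_add, MonoidAlgebra.coeff_smul, Finsupp.add_apply, Finsupp.smul_apply,
    coeff_xA, coeff_xA, smul_eq_mul, ← sum_ite_increasingUpTo hk, xA_pred_eq_sum, Finset.sum_mul,
    MonoidAlgebra.coeff_sum, Finsupp.finsetSum_apply]
  refine Finset.sum_congr rfl fun q _ => ?_
  rw [MonoidAlgebra.of_apply, MonoidAlgebra.coeff_single_mul_apply, one_mul, coeff_xA, map_mul,
    ← map_inv, inv_inv]
  congr 3
  exact (MulEquiv.ofBijective _ (toPerm_bijective cs)).apply_symm_apply _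

theorem coeff_xA_simple (cs : CoxeterSystem (CoxeterMatrix.A n) W) (k : ℕ) (i : Fin n) :
    (xA cs k).coeff (cs.simple i) = if k ≤ i then 1 else 0 := by
  classical
  rw [coeff_xA]
  refine if_congr ⟨fun h => ?_, fun h j hj => ?_⟩ rfl rfl
  · by_contra! hi
    simpa [Fin.lt_def] using h i hi
  · rw [toPerm_simple, Equiv.swap_apply_def, Equiv.swap_apply_def]
    simp only [Fin.lt_def, Fin.ext_iff, apply_ite Fin.val, Fin.val_succ, Fin.val_castSucc]
    split_ifs <;> omega

theorem linearIndependent_xA (cs : CoxeterSystem (CoxeterMatrix.A n) W) :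
    LinearIndependent ℚ fun k : Fin (n + 1) => xA cs k := by
  rw [Fintype.linearIndependent_iff]
  intro g hg
  -- The coefficient of the relation at the generator labelled i is the partial sum up to i; at 1 it
  -- is the full sum.
  have hsum : ∀ j : Fin (n + 1), ∑ k ∈ Finset.Iic j, g k = 0 := by
    intro j
    have happ : ∀ w, ∑ k, g k * (xA cs k).coeff w = 0 := fun w => by
      have := congrArg (fun x => x.coeff w) hg
      simpa [MonoidAlgebra.coeff_sum, Finsupp.finsetSum_apply] using this
    induction j using Fin.lastCases with
    | last =>
      have := happ 1
      classical
      simp only [coeff_xA, map_one] at this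
      rw [← this, show Finset.Iic (Fin.last n) = Finset.univ by ext; simp [Fin.le_last]]
      refine Finset.sum_congr rfl fun k _ => ?_
      rw [if_pos, mul_one]
      intro i _
      simp
    | cast i =>
      have := happ (cs.simple i)
      simp only [coeff_xA_simple, mul_ite, mul_one, mul_zero, ← Finset.sum_filter] at this
      rw [← this]
      congr 1
      ext; simp [Fin.le_def]
  intro j
  induction j using Fin.induction with
  | zero => simpa [show Finset.Iic (0 : Fin (n + 1)) = {0} from Finset.Iic_bot] using hsum 0
  | succ i _ =>
    have h1 := hsum i.succ
    have h2 : Finset.Iic i.succ = insert i.succ (Finset.Iic i.castSucc) := by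
      ext; simp [Fin.le_def, Fin.ext_iff]; omega
    rw [h2, Finset.sum_insert (by simp), hsum] at h1
    simpa using h1

end

/-! ### Linearization of products of falling factorials -/

-- Induction on d, splitting the new factor as X - d = (X - (d + e - r)) + (e - r): the first
-- summand raises the degree, the second keeps it.
open Polynomial in
theorem descPochhammer_mul_descPochhammer (d e : ℕ) :
    descPochhammer ℚ d * descPochhammer ℚ e =
      ∑ r ∈ Finset.range (e + 1), (d.choose r * e.choose r * r.factorial : ℚ) •
        descPochhammer ℚ (d + e - r) := by
  induction d with
  | zero =>
    rw [Finset.sum_range_succ']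
    simp
  | succ d ih =>
    have hstep : ∀ r ∈ Finset.range (e + 1), (X - (d : ℚ[X])) * descPochhammer ℚ (d + e - r) =
        descPochhammer ℚ (d + 1 + e - r) + ((e : ℚ) - r) • descPochhammer ℚ (d + e - r) := by
      intro r hr
      have hr : r ≤ e := by simpa [Nat.lt_succ_iff] using hr
      rw [show d + 1 + e - r = d + e - r + 1 by omega, descPochhammer_succ_right,
        Nat.cast_sub (by omega), smul_eq_C_mul]
      push_cast [C_sub]
      simp only [map_natCast]
      ring
    rw [descPochhammer_succ_right, mul_comm (descPochhammer ℚ d), mul_assoc, ih, Finset.mul_sum]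
    simp only [mul_smul_comm]
    rw [Finset.sum_congr rfl fun r hr => congrArg _ (hstep r hr)]
    simp only [smul_add, Finset.sum_add_distrib, smul_smul]
    -- The term r = e vanishes, so the second sum aligns with the first after shifting r by one;
    -- Pascal's rule then combines the coefficients.
    have h2 := Finset.sum_range_succ (fun r => (d.choose r * e.choose r * r.factorial *
      ((e : ℚ) - r)) • descPochhammer ℚ (d + e - r)) e
    rw [sub_self, mul_zero, zero_smul, add_zero] at h2
    rw [h2, Finset.sum_range_succ' _ e, Finset.sum_range_succ' _ e]
    rw [add_right_comm, ← Finset.sum_add_distrib]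
    congr 1
    · refine Finset.sum_congr rfl fun r hr => ?_
      have hr : r < e := by simpa using hr
      rw [show d + 1 + e - (r + 1) = d + e - r by omega, ← add_smul]
      congr 1
      have h1 : (e.choose (r + 1) : ℚ) * (r + 1) = e.choose r * (e - r) := by
        have := Nat.choose_succ_right_eq e r
        rw [← Nat.cast_sub hr.le]
        exact_mod_cast this
      rw [Nat.choose_succ_succ, Nat.factorial_succ]
      push_cast
      linear_combination (-(d.choose r : ℚ) * r.factorial) * h1
    · simp

/-! ### Structure constants and the native basis -/

section

variable {n : ℕ} {W : Type*} [Group W] [Finite W]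

-- The recursion says (x_{n-1} - d) x_{n-d} = x_{n-d-1}. The case d = n + 1 is included since `n -
-- d` truncates to 0.
open Polynomial in
theorem aeval_descPochhammer_xA (cs : CoxeterSystem (CoxeterMatrix.A n) W) {d : ℕ}
    (hd : d ≤ n + 1) : aeval (xA cs (n - 1)) (descPochhammer ℚ d) = xA cs (n - d) := by
  induction d with
  | zero => simp [xA_self]
  | succ d ih =>
    rw [descPochhammer_succ_right, mul_comm, map_mul, ih (by omega), map_sub, aeval_X, map_natCast,
      sub_mul, xA_pred_mul cs (Nat.sub_le n d), Nat.cast_sub (by omega), sub_sub_cancel,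
      ← nsmul_eq_mul, ← Nat.cast_smul_eq_nsmul ℚ, add_sub_cancel_left, Nat.sub_sub]

open Polynomial in
theorem aeval_descPochhammer_xA_eq_zero (cs : CoxeterSystem (CoxeterMatrix.A n) W) {d : ℕ}
    (hd : n + 2 ≤ d) : aeval (xA cs (n - 1)) (descPochhammer ℚ d) = 0 := by
  induction d, hd using Nat.le_induction with
  | base =>
    have h := xA_pred_mul cs (Nat.zero_le n)
    rw [show n + 2 = n + 1 + 1 from rfl, descPochhammer_succ_right, mul_comm, map_mul,
      aeval_descPochhammer_xA cs le_rfl, map_sub, aeval_X, map_natCast, sub_mul,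
      show n - (n + 1) = 0 by omega, h, ← nsmul_eq_mul, ← Nat.cast_smul_eq_nsmul ℚ]
    push_cast
    module
  | succ d hd ih => rw [descPochhammer_succ_right, map_mul, ih, zero_mul]

open Polynomial in
theorem xA_mul_xA (cs : CoxeterSystem (CoxeterMatrix.A n) W) {j k : ℕ} (hj : j ≤ n) (hk : k ≤ n) :
    xA cs j * xA cs k = ∑ l ∈ Finset.Icc (-1 : ℤ) (min (j : ℤ) (k : ℤ)),
      (coeffA n j k l : ℚ) • xA cs l.toNat := by
  have hx : ∀ {i}, i ≤ n → xA cs i = aeval (xA cs (n - 1)) (descPochhammer ℚ (n - i)) := by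
    intro i hi
    rw [aeval_descPochhammer_xA cs (by omega), Nat.sub_sub_self hi]
  rw [hx hj, hx hk, ← map_mul, descPochhammer_mul_descPochhammer, map_sum]
  simp only [map_smul]
  -- Without this, `toNat` would send several l to r = 0, and the reindexing r = n - j - k + l would
  -- not be injective.
  have hle : ∀ l, (coeffA n j k l : ℚ) • xA cs l.toNat ≠ 0 → 0 ≤ (n : ℤ) - j - k + l := by
    intro l hne
    by_contra! hneg
    refine hne ?_
    rw [coeffA, Nat.choose_eq_zero_of_lt (by omega)]
    simp
  have hterm : ∀ l ∈ Finset.Icc (-1 : ℤ) (min (j : ℤ) (k : ℤ)), ∀ r : ℕ,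
      (r : ℤ) = (n : ℤ) - j - k + l → (coeffA n j k l : ℚ) • xA cs l.toNat =
        ((n - j).choose r * (n - k).choose r * r.factorial : ℚ) •
          aeval (xA cs (n - 1)) (descPochhammer ℚ (n - j + (n - k) - r)) := by
    intro l hl r hr
    simp only [Finset.mem_Icc, le_min_iff] at hl
    rw [aeval_descPochhammer_xA cs (by omega), coeffA,
      show n - (n - j + (n - k) - r) = l.toNat by omega,
      show ((k : ℤ) - l).toNat = n - j - r by omega, Nat.choose_symm (by omega),
      show ((j : ℤ) - l).toNat = n - k - r by omega, Nat.choose_symm (by omega),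
      show ((n : ℤ) - j - k + l).toNat = r by omega]
    push_cast
    rfl
  symm
  refine Finset.sum_bij_ne_zero (fun l _ _ => ((n : ℤ) - j - k + l).toNat) ?_ ?_ ?_ ?_
  · intro l hl _
    simp only [Finset.mem_Icc, Finset.mem_range, le_min_iff] at *
    omega
  · intro l _ hl l' _ hl' h
    have := hle l hl
    have := hle l' hl'
    omega
  · intro r hr hne
    have hrj : r ≤ n - j := by
      by_contra! h
      exact hne (by rw [Nat.choose_eq_zero_of_lt h]; simp)
    have hrk : r ≤ n - k := by simpa [Nat.lt_succ_iff] using hr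
    -- The vanishing in degrees above n + 1 is what bounds l below by -1.
    have hr1 : n - j + (n - k) - r ≤ n + 1 := by
      by_contra! h
      exact hne (by rw [aeval_descPochhammer_xA_eq_zero cs (by omega), smul_zero])
    have hmem : (r : ℤ) - n + j + k ∈ Finset.Icc (-1 : ℤ) (min (j : ℤ) (k : ℤ)) := by
      simp only [Finset.mem_Icc, le_min_iff]
      omega
    exact ⟨_, hmem, by rwa [hterm _ hmem r (by ring)], by omega⟩
  · intro l hl hne
    exact hterm l hl _ (Int.toNat_of_nonneg (hle l hne))

theorem xA_mem_algE (cs : CoxeterSystem (CoxeterMatrix.A n) W) {k : ℕ} (hk : k ≤ n) :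
    xA cs k ∈ algE cs := by
  have h := aeval_descPochhammer_xA cs (d := n - k) (by omega)
  rw [Nat.sub_sub_self hk] at h
  rw [← h]
  exact Polynomial.aeval_mem_adjoin_singleton _ _

/-- The span contains 1 = x_n and is stable under left multiplication by x_{n-1}, hence contains all
its powers. -/
theorem algE_le_span (cs : CoxeterSystem (CoxeterMatrix.A n) W) :
    Subalgebra.toSubmodule (algE cs) ≤
      Submodule.span ℚ (Set.range fun k : Fin (n + 1) => xA cs k) := by
  have hmem : ∀ k ≤ n, xA cs k ∈ Submodule.span ℚ (Set.range fun k : Fin (n + 1) => xA cs k) :=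
    fun k hk => Submodule.subset_span ⟨⟨k, by omega⟩, rfl⟩
  have hmul : ∀ y ∈ Submodule.span ℚ (Set.range fun k : Fin (n + 1) => xA cs k),
      xA cs (n - 1) * y ∈ Submodule.span ℚ (Set.range fun k : Fin (n + 1) => xA cs k) := by
    intro y hy
    induction hy using Submodule.span_induction with
    | mem y hy =>
      obtain ⟨k, rfl⟩ := hy
      beta_reduce
      rw [xA_pred_mul cs (by omega)]
      exact add_mem (Submodule.smul_mem _ _ (hmem _ (by omega))) (hmem _ (by omega))
    | zero => simp
    | add y z _ _ hy hz => rw [mul_add]; exact add_mem hy hz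
    | smul c y _ hy => rw [mul_smul_comm]; exact Submodule.smul_mem _ _ hy
  rw [algE, Algebra.adjoin_eq_span, Submodule.span_le]
  rintro _ hx
  obtain ⟨m, rfl⟩ := Submonoid.mem_closure_singleton.1 hx
  induction m with
  | zero => simpa [xA_self] using hmem n le_rfl
  | succ m ih =>
    rw [pow_succ']
    exact hmul _ (ih (Submonoid.mem_closure_singleton.2 ⟨m, rfl⟩))

/-- The basis `x_0, …, x_n` of `𝔈(W)`. -/
def basisAlgE (cs : CoxeterSystem (CoxeterMatrix.A n) W) :
    Module.Basis (Fin (n + 1)) ℚ (algE cs) :=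
  Module.Basis.mk (v := fun k => ⟨xA cs k, xA_mem_algE cs (Nat.lt_succ_iff.1 k.2)⟩)
    (LinearIndependent.of_comp (algE cs).val.toLinearMap (linearIndependent_xA cs)) (by
      rintro ⟨y, hy⟩ -
      have h := algE_le_span cs hy
      have hmap : Submodule.span ℚ (Set.range fun k : Fin (n + 1) => xA cs k) =
          (Submodule.span ℚ (Set.range fun k : Fin (n + 1) => (⟨xA cs k, xA_mem_algE cs
            (Nat.lt_succ_iff.1 k.2)⟩ : algE cs))).map (algE cs).val.toLinearMap := by
        rw [Submodule.map_span, ← Set.range_comp]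
        rfl
      rw [hmap] at h
      obtain ⟨z, hz, e⟩ := h
      rwa [← show z = ⟨y, hy⟩ from Subtype.ext e])

@[simp]
theorem coe_basisAlgE (cs : CoxeterSystem (CoxeterMatrix.A n) W) (k : Fin (n + 1)) :
    (basisAlgE cs k : MonoidAlgebra ℚ W) = xA cs k := by
  simp [basisAlgE]

theorem isNative_basisAlgE (cs : CoxeterSystem (CoxeterMatrix.A n) W) :
    IsNative cs (basisAlgE cs) := by
  refine ⟨(algE_le_span cs).trans (Submodule.span_mono ?_), fun k => ⟨_, coe_basisAlgE cs k⟩⟩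
  rintro _ ⟨k, rfl⟩
  exact ⟨_, rfl⟩

theorem basisAlgE_repr_mul (cs : CoxeterSystem (CoxeterMatrix.A n) W) (j k l : Fin (n + 1)) :
    (basisAlgE cs).repr (basisAlgE cs j * basisAlgE cs k) l =
      ∑ m ∈ Finset.Icc (-1 : ℤ) (min ((j : ℕ) : ℤ) ((k : ℕ) : ℤ)) with m.toNat = (l : ℕ),
        (coeffA n (j : ℕ) (k : ℕ) m : ℚ) := by
  have h : basisAlgE cs j * basisAlgE cs k =
      ∑ m ∈ Finset.Icc (-1 : ℤ) (min ((j : ℕ) : ℤ) ((k : ℕ) : ℤ)),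
        (coeffA n j k m : ℚ) • basisAlgE cs (Fin.ofNat (n + 1) m.toNat) := by
    apply Subtype.ext
    rw [Subalgebra.coe_mul, coe_basisAlgE, coe_basisAlgE, xA_mul_xA cs (by omega) (by omega),
      AddSubmonoidClass.coe_finsetSum]
    refine Finset.sum_congr rfl fun m hm => ?_
    simp only [Finset.mem_Icc, le_min_iff] at hm
    rw [Subalgebra.coe_smul, coe_basisAlgE, Fin.val_ofNat, Nat.mod_eq_of_lt (by omega)]
  rw [h, map_sum, Finsupp.finsetSum_apply, Finset.sum_filter]
  refine Finset.sum_congr rfl fun m hm => ?_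
  simp only [Finset.mem_Icc, le_min_iff] at hm
  rw [map_smul, Module.Basis.repr_self, Finsupp.smul_apply, Finsupp.single_apply]
  simp only [Fin.ext_iff, Fin.val_ofNat, Nat.mod_eq_of_lt (show m.toNat < n + 1 by omega)]
  simp

end

end NativeDescent

end

/-- The index `l.toNat` is `l` for `l ≥ 0`, and `0` for `l = -1`: this is `x_{-1} := x_0`. -/
theorem mainTheorem7 {n : ℕ} (hn : 1 ≤ n) {W : Type*} [Group W] [Finite W]
    (cs : CoxeterSystem (CoxeterMatrix.A n) W) :
    (∀ j k : ℕ, j ≤ n → k ≤ n →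
      NativeDescent.xA cs j * NativeDescent.xA cs k =
        ∑ l ∈ Finset.Icc (-1 : ℤ) (min (j : ℤ) (k : ℤ)),
          (NativeDescent.coeffA n j k l : ℚ) • NativeDescent.xA cs l.toNat) ∧
    ∃ b : Module.Basis (Fin (n + 1)) ℚ (NativeDescent.algE cs),
      NativeDescent.IsNative cs b ∧
      (∀ j : Fin (n + 1), (b j : MonoidAlgebra ℚ W) = NativeDescent.xA cs (j : ℕ)) ∧
      ∀ j k l : Fin (n + 1),
        b.repr (b j * b k) l =
          ∑ m ∈ Finset.Icc (-1 : ℤ) (min ((j : ℕ) : ℤ) ((k : ℕ) : ℤ)) with m.toNat = (l : ℕ),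
            (NativeDescent.coeffA n (j : ℕ) (k : ℕ) m : ℚ) :=
  ⟨fun _ _ => NativeDescent.xA_mul_xA cs, NativeDescent.basisAlgE cs,
    NativeDescent.isNative_basisAlgE cs, NativeDescent.coe_basisAlgE cs,
    NativeDescent.basisAlgE_repr_mul cs⟩
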